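/- Let $n\ge 2$ be even and let $\rho$ be a state of $n$ qubits $\mathcal A=\{A_1,\dots,A_n\}$, i.e. a positive semidefinite operator of trace one on $(\mathbb C^2)^{\otimes n}$. For $J\subseteq\mathcal A$ let $\rho_J$ be the marginal of $\rho$ on $J$ (the partial trace over the qubits outside $J$), let $S_2(J)=1-\operatorname{Tr}\rho_J^2$ be the linear entropy (so $S_2(\varnothing)=0$), and put $$C_2(J)=\sum_{v\in J}S_2(\{v\})-S_2(J),\qquad I_2(\mathcal A)_\rho=\sum_{\varnothing\ne J\subseteq\mathcal A}(-1)^{|J|-1}S_2(J).$$ Then $C_2$ is monotone, $C_2(I)\le C_2(J)$ for $\varnothing\neq I\subseteq J\subseteq\mathcal A$, so that $G(\varepsilon)=\{\varnothing\ne J\subseteq\mathcal A : C_2(J)\le\varepsilon\}$, $\varepsilon\in\mathbb R$, is a filtration of abstract simplicial complexes. Fix a field $K$ and let $\widetilde\beta_k(\varepsilon)=\dim_K\widetilde H_k(G(\varepsilon);K)$ be the reduced Betti numbers, computed from the augmented simplicial chain complex. Each $\widetilde\beta_k$ is integrable on $(0,\infty)$, and the reduced integrated Euler characteristic $$\widetilde{\mathfrak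 X}_2(\varepsilon)=\sum_{k\ge 0}(-1)^k\int_0^{\varepsilon}\widetilde\beta_k(\varepsilon')\,d\varepsilon'$$ has a limit $\widetilde{\mathfrak X}_2(\infty)$ as $\varepsilon\to\infty$, with $$\widetilde{\mathfrak X}_2(\infty)=I_2(\mathcal A)_\rho=Q_{(n)}^2=\tau_n(\rho).$$ Here $Q_{(n)}^2=\frac1{2^n}\sum_{\iota\in\{0,1,2,3\}^n}(-1)^{|\iota|}Q_\iota^2$ is the Minkowski length of the generalized Bloch vector $Q_\iota=\operatorname{Tr}\bigl(\rho\,(\sigma_{\iota_1}\otimes\cdots\otimes\sigma_{\iota_n})\bigr)$, where $\sigma_0$ is the $2\times 2$ identity matrix, $\sigma_1,\sigma_2,\sigma_3$ are the Pauli matrices and $|\iota|$ is the number of $j$ with $\iota_j\neq0$; and $\tau_n(\rho)=\operatorname{Tr}(\rho\,\sigma_2^{\otimes n}\rho^*\sigma_2^{\otimes n})$ is the $n$-tangle, $\rho^*$ being the entrywise complex conjugate of $\rho$ in the standard product basis. -/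

import Mathlib

open scoped ComplexOrder

noncomputable section

/-! ### Simplicial homology of a finite ordered complex -/

namespace Persistence

variable {n : ℕ}

/-- The simplices with `m` vertices of the augmented complex: the faces of `G` with `m` vertices,
together with the empty simplex when `m = 0`. In the usual grading they have dimension `m - 1`. -/
def Simplex (G : PreAbstractSimplicialComplex (Fin n)) (m : ℕ) : Type :=
  {J : Finset (Fin n) // J.card = m ∧ (J = ∅ ∨ J ∈ G.faces)}

instance (G : PreAbstractSimplicialComplex (Fin n)) (m : ℕ) : DecidableEq (Simplex G m) :=
  inferInstanceAs (DecidableEq {J : Finset (Fin n) // J.card = m ∧ (J = ∅ ∨ J ∈ G.faces)})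

instance (G : PreAbstractSimplicialComplex (Fin n)) (m : ℕ) : Finite (Simplex G m) :=
  inferInstanceAs (Finite {J : Finset (Fin n) // J.card = m ∧ (J = ∅ ∨ J ∈ G.faces)})

instance (G : PreAbstractSimplicialComplex (Fin n)) (m : ℕ) : Fintype (Simplex G m) :=
  Fintype.ofFinite _

/-- The face of a simplex obtained by omitting the vertex `v`. -/
def Simplex.face {G : PreAbstractSimplicialComplex (Fin n)} {m : ℕ} (σ : Simplex G (m + 1))
    (v : Fin n) (hv : v ∈ σ.1) : Simplex G m :=
  ⟨σ.1.erase v, by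
    obtain ⟨J, hc, hJ⟩ := σ
    refine ⟨by rw [Finset.card_erase_of_mem hv, hc]; rfl, ?_⟩
    rcases Finset.eq_empty_or_nonempty (J.erase v) with h | h
    · exact Or.inl h
    · refine Or.inr ?_
      rcases hJ with rfl | hJ
      · simp at hv
      · exact (G.isRelLowerSet_faces hJ).2 (Finset.erase_subset v J) h⟩

/-- Simplicial chains on the simplices with `m` vertices, with coefficients in `K`: a chain
`∑ σ, c σ • σ` is given by its coefficients, and the simplex `σ` itself is `Pi.single σ 1`. -/
abbrev Chain (K : Type*) [Field K] (G : PreAbstractSimplicialComplex (Fin n)) (m : ℕ) : Type _ :=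
  Simplex G m → K

/-- The boundary map of the augmented chain complex. On a simplex with vertices
`v₀ < v₁ < ⋯ < vₘ` it is `∑ i, (-1) ^ i (v₀, …, v̂ᵢ, …, vₘ)`. On a vertex its value is the empty
simplex with coefficient `1`, so that for `m = 0` it is the augmentation `φ`, which sums the
coefficients of a `0`-chain. -/
def boundary (K : Type*) [Field K] (G : PreAbstractSimplicialComplex (Fin n)) (m : ℕ) :
    Chain K G (m + 1) →ₗ[K] Chain K G m :=
  Fintype.linearCombination K fun σ : Simplex G (m + 1) =>
    ∑ v : {v // v ∈ σ.1},
      Pi.single (σ.face v.1 v.2) ((-1 : K) ^ (σ.1.filter (· < v.1)).card)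

/-- `∂ ∘ ∂ = 0`, so boundaries are cycles. -/
theorem boundary_comp_boundary {n : ℕ} (K : Type*) [Field K] (G : PreAbstractSimplicialComplex (Fin n)) (m : ℕ) :
    boundary K G m ∘ₗ boundary K G (m + 1) = 0 := by
  refine LinearMap.pi_ext' fun σ => LinearMap.ext_ring ?_
  simp only [boundary, LinearMap.comp_apply, LinearMap.single_apply,
    Fintype.linearCombination_apply_single, one_smul, map_sum, LinearMap.zero_apply, Finset.smul_sum]
  rw [Finset.sum_sigma']
  refine Finset.sum_involution (fun x _ => ⟨⟨x.2.1, Finset.mem_of_mem_erase x.2.2⟩,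
      ⟨x.1.1, Finset.mem_erase.2 ⟨(Finset.ne_of_mem_erase x.2.2).symm, x.1.2⟩⟩⟩) ?_ ?_ ?_ ?_
  · rintro ⟨⟨v, hv⟩, ⟨w, hw⟩⟩ -
    have hw' : w ∈ σ.1.erase v := hw
    have hwv := Finset.ne_of_mem_erase hw'
    have hwσ := Finset.mem_of_mem_erase hw'
    have key : ∀ v w : Fin n, v ∈ σ.1 → w ∈ σ.1 → v < w →
        (-1:K)^(σ.1.filter (· < v)).card * (-1)^((σ.1.erase v).filter (· < w)).card
        + (-1:K)^(σ.1.filter (· < w)).card * (-1)^((σ.1.erase w).filter (· < v)).card = 0 := by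
      intro v w hv hw h
      rw [Finset.filter_erase, Finset.filter_erase]
      rw [Finset.erase_eq_of_notMem (s := σ.1.filter (· < v)) (by simp [h.le])]
      have : v ∈ σ.1.filter (· < w) := by simp [hv, h]
      have := Finset.card_erase_add_one this
      rw [← this, pow_succ]; ring
    have e : (σ.face v hv).face w hw = (σ.face w hwσ).face v (Finset.mem_erase.2 ⟨hwv.symm, hv⟩) := by
      apply Subtype.ext; exact Finset.erase_right_comm
    simp only [e, ← Pi.single_smul, smul_eq_mul, ← Pi.single_add]
    rw [Pi.single_eq_zero_iff]
    rcases lt_or_gt_of_ne hwv with h | h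
    · rw [add_comm]; exact key w v hwσ hv h
    · exact key v w hv hwσ h
  · rintro ⟨⟨v, hv⟩, ⟨w, hw⟩⟩ - - h
    have := Finset.ne_of_mem_erase (show w ∈ σ.1.erase v from hw)
    simp at h; exact this h.1
  · intros; simp
  · intros; rfl

/-- The reduced simplicial homology `H̃ₖ(G; K) = ker ∂ₖ / im ∂ₖ₊₁`. A `k`-simplex has `k + 1`
vertices, so `∂ₖ` is `boundary K G k`. -/
abbrev ReducedHomology (K : Type*) [Field K] (G : PreAbstractSimplicialComplex (Fin n)) (k : ℕ) :
    Type _ :=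
  LinearMap.ker (boundary K G k) ⧸
    (LinearMap.range (boundary K G (k + 1))).submoduleOf (LinearMap.ker (boundary K G k))

/-- The reduced Betti number `β̃ₖ(G)`. -/
def reducedBetti (K : Type*) [Field K] (G : PreAbstractSimplicialComplex (Fin n)) (k : ℕ) : ℕ :=
  Module.finrank K (ReducedHomology K G k)

/-! ### The sublevel filtration of a monotone functional -/

/-- Monotonicity of a functional on the nonempty subsets of the vertex set. -/
def IsFaceMonotone (F : Finset (Fin n) → ℝ) : Prop :=
  ∀ I J : Finset (Fin n), I.Nonempty → I ⊆ J → F I ≤ F J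

/-- The complex `G(ε) = {J ≠ ∅ : F(J) ≤ ε}`. -/
def sublevelComplex (F : Finset (Fin n) → ℝ) (hF : IsFaceMonotone F) (ε : ℝ) :
    PreAbstractSimplicialComplex (Fin n) where
  faces := {J | J.Nonempty ∧ F J ≤ ε}
  isRelLowerSet_faces := fun {_} hJ =>
    ⟨hJ.1, fun {I} hIJ hI => ⟨hI, (hF I _ hI hIJ).trans hJ.2⟩⟩

/-- The reduced integrated Betti number `𝔅̃ₖ(ε) = ∫₀^ε β̃ₖ(G(ε')) dε'`. -/
def reducedIntegratedBetti (K : Type*) [Field K] (F : Finset (Fin n) → ℝ) (hF : IsFaceMonotone F)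
    (k : ℕ) (ε : ℝ) : ℝ :=
  ∫ t in (0 : ℝ)..ε, (reducedBetti K (sublevelComplex F hF t) k : ℝ)

/-- The reduced integrated Euler characteristic `𝔛̃(ε) = ∑ₖ (-1)ᵏ 𝔅̃ₖ(ε)`. The sum is finite, as
there are no `k`-simplices for `k ≥ n`. -/
def reducedIEC (K : Type*) [Field K] (F : Finset (Fin n) → ℝ) (hF : IsFaceMonotone F)
    (ε : ℝ) : ℝ :=
  ∑' k : ℕ, (-1 : ℝ) ^ k * reducedIntegratedBetti K F hF k ε

end Persistence

/-! ### States of `n` qubits -/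

namespace Qubits

variable {n : ℕ}

/-- Operators on the `n`-qubit space `(ℂ²)^{⊗ n}`, as matrices in the product basis, which is
indexed by `Fin n → Fin 2`. -/
abbrev Operator (n : ℕ) : Type := Matrix (Fin n → Fin 2) (Fin n → Fin 2) ℂ

/-- Density operators: positive semidefinite of trace one. -/
def IsState (ρ : Operator n) : Prop := ρ.PosSemidef ∧ ρ.trace = 1

/-- The reduced operator `ρ_J`: the partial trace of `ρ` over the qubits outside `J`. -/
def marginal (ρ : Operator n) (J : Finset (Fin n)) :
    Matrix ({i // i ∈ J} → Fin 2) ({i // i ∈ J} → Fin 2) ℂ :=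
  fun a b => ∑ c : {i // i ∉ J} → Fin 2,
    ρ ((Equiv.piEquivPiSubtypeProd (· ∈ J) fun _ => Fin 2).symm (a, c))
      ((Equiv.piEquivPiSubtypeProd (· ∈ J) fun _ => Fin 2).symm (b, c))

/-- The linear entropy `S₂(J) = 1 - Tr ρ_J²`. For a Hermitian operator this trace is real, and for
a state `S₂(∅) = 0`. -/
def linearEntropy (ρ : Operator n) (J : Finset (Fin n)) : ℝ :=
  1 - (marginal ρ J * marginal ρ J).trace.re

/-- The deformed total correlation `C₂(J) = ∑_{v ∈ J} S₂(v) - S₂(J)`. -/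
def totalCorrelation (ρ : Operator n) (J : Finset (Fin n)) : ℝ :=
  ∑ v ∈ J, linearEntropy ρ {v} - linearEntropy ρ J

/-- The deformed interaction information `I₂ = ∑_J (-1)^{|J| - 1} S₂(J)` over the nonempty subsets
`J` of the set of qubits; the empty set does not contribute, since `S₂(∅) = 0`. -/
def interactionInformation (ρ : Operator n) : ℝ :=
  ∑ J : Finset (Fin n) with J.Nonempty, (-1 : ℝ) ^ (J.card - 1) * linearEntropy ρ J

/-- The identity `σ₀` and the Pauli matrices `σ₁, σ₂, σ₃`. -/
def pauli : Fin 4 → Matrix (Fin 2) (Fin 2) ℂ :=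
  ![!![1, 0; 0, 1], !![0, 1; 1, 0], !![0, -Complex.I; Complex.I, 0], !![1, 0; 0, -1]]

/-- The Pauli string `σ_{i₁} ⊗ ⋯ ⊗ σ_{iₙ}`. -/
def pauliString (ι : Fin n → Fin 4) : Operator n :=
  fun a b => ∏ j, pauli (ι j) (a j) (b j)

/-- The coordinate `Q_ι = Tr(ρ σ_ι)` of the generalized Bloch vector. -/
def blochVector (ρ : Operator n) (ι : Fin n → Fin 4) : ℂ :=
  (ρ * pauliString ι).trace

/-- The weight `|ι|`: the number of qubits on which `σ_ι` acts nontrivially. -/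
def weight (ι : Fin n → Fin 4) : ℕ := (Finset.univ.filter fun j => ι j ≠ 0).card

/-- The Minkowski length `Q_(n)² = 2⁻ⁿ ∑_ι (-1)^{|ι|} Q_ι²` of the generalized Bloch vector. -/
def minkowskiLength (ρ : Operator n) : ℂ :=
  1 / 2 ^ n * ∑ ι : Fin n → Fin 4, (-1 : ℂ) ^ weight ι * blochVector ρ ι ^ 2

/-- The `n`-tangle `τₙ(ρ) = Tr(ρ σ₂^{⊗ n} ρ* σ₂^{⊗ n})`, where `ρ*` is the entrywise complex
conjugate of `ρ`. -/
def nTangle (ρ : Operator n) : ℂ :=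
  (ρ * pauliString (fun _ => 2) * ρ.map (starRingEnd ℂ) * pauliString (fun _ => 2)).trace

end Qubits

end

/-!
Let `F_J` exchange the qubits in `J` between two copies of the system. Then
`Tr ρ_J² = Tr ((ρ ⊗ ρ) F_J)`, and the `F_J` are commuting self-adjoint involutions with
`F_I F_J = F_(I ∆ J)`. Hence `(1 - F_I) (1 - F_J)` is a positive multiple of a projection, so that
`S₂ (I ∆ J) ≤ S₂ (I) + S₂ (J)`; for disjoint sets this is subadditivity, and it makes `C₂` monotone.

By the Euler–Poincaré formula the alternating sum of the reduced Betti numbers of `G(t)` is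
`-1 - ∑ (-1)^|J|`, summed over the nonempty `J` with `C₂(J) ≤ t`. Integrating over `t`, each `J`
contributes through the length of `[C₂(J), ε]`, and the total is `∑ (-1)^|J| C₂(J)`. The additive
part `∑_{v ∈ J} S₂(v)` of `C₂` cancels in this sum, which leaves `I₂`. For `ε` beyond the largest
value of `C₂` the complex is a full simplex and contributes nothing more.

Finally `I₂ = Tr ((ρ ⊗ ρ) ∑ (-1)^|J| F_J)`, and `∑ (-1)^|J| F_J` is the product of `1 - F_j` over
the single qubits. Each factor is half the signed sum of the `σ_i ⊗ σ_i`, which gives the Minkowski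
length, and it is also the rank-one matrix built from the entries of `σ₂`, which gives the
`n`-tangle.
-/

/-! ### Alternating sums over subsets -/

section AlternatingSums

variable {V R : Type*} [Ring R]

theorem neg_one_pow_card_sub_one {J : Finset V} (hJ : J.Nonempty) :
    (-1 : R) ^ (J.card - 1) = -(-1) ^ J.card := by
  rw [← Nat.sub_add_cancel hJ.card_pos, pow_succ, Nat.add_sub_cancel]
  simp only [mul_neg, mul_one, neg_neg]

theorem sum_powerset_neg_one_pow_card_eq_zero {s : Finset V} (hs : s.Nonempty) :
    ∑ J ∈ s.powerset, (-1 : R) ^ J.card = 0 := by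
  exact_mod_cast congrArg (Int.cast : ℤ → R)
    (Finset.sum_powerset_neg_one_pow_card_of_nonempty hs)

variable [Fintype V]

theorem sum_neg_one_pow_card_eq_zero [Nonempty V] : ∑ J : Finset V, (-1 : R) ^ J.card = 0 := by
  rw [← Finset.powerset_univ]
  exact sum_powerset_neg_one_pow_card_eq_zero Finset.univ_nonempty

theorem sum_eq_empty_add_sum_nonempty {M : Type*} [AddCommMonoid M] (f : Finset V → M) :
    ∑ J, f J = f ∅ + ∑ J with J.Nonempty, f J := by
  classical
  rw [← Finset.add_sum_erase _ f (Finset.mem_univ ∅)]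
  congr 2
  ext J
  simp only [Finset.mem_erase, Finset.mem_univ, and_true, Finset.mem_filter, true_and,
    Finset.nonempty_iff_ne_empty]

theorem sum_nonempty_neg_one_pow_card [Nonempty V] :
    ∑ J : Finset V with J.Nonempty, (-1 : R) ^ J.card = -1 := by
  have h := sum_eq_empty_add_sum_nonempty fun J : Finset V => (-1 : R) ^ J.card
  rw [sum_neg_one_pow_card_eq_zero, Finset.card_empty, pow_zero] at h
  exact (neg_eq_of_add_eq_zero_right h.symm).symm

variable [Nontrivial V]

theorem sum_mem_neg_one_pow_card_eq_zero [DecidableEq V] (v : V) :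
    ∑ J : Finset V with v ∈ J, (-1 : R) ^ J.card = 0 := by
  obtain ⟨w, hw⟩ := exists_ne v
  have hcompl : (Finset.univ.erase v).Nonempty := ⟨w, Finset.mem_erase.2 ⟨hw, Finset.mem_univ w⟩⟩
  have hnot {J : Finset V} (hJ : J ∈ (Finset.univ.erase v).powerset) : v ∉ J := fun h =>
    Finset.notMem_erase v _ (Finset.mem_powerset.1 hJ h)
  rw [Finset.sum_filter, ← Finset.powerset_univ, ← Finset.insert_erase (Finset.mem_univ v),
    Finset.sum_powerset_insert (Finset.notMem_erase v _),
    Finset.sum_eq_zero fun J hJ => if_neg (hnot hJ), zero_add,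
    ← neg_zero, ← sum_powerset_neg_one_pow_card_eq_zero hcompl, ← Finset.sum_neg_distrib]
  refine Finset.sum_congr rfl fun J hJ => ?_
  rw [if_pos (Finset.mem_insert_self v J), Finset.card_insert_of_notMem (hnot hJ), pow_succ,
    mul_neg_one]

theorem sum_neg_one_pow_card_mul_sum_eq_zero (f : V → R) :
    ∑ J : Finset V, (-1) ^ J.card * ∑ v ∈ J, f v = 0 := by
  classical
  simp_rw [Finset.mul_sum]
  rw [Finset.sum_comm' (t' := Finset.univ) (s' := fun v => {J : Finset V | v ∈ J}) (by simp)]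
  simp only [← Finset.sum_mul, sum_mem_neg_one_pow_card_eq_zero, zero_mul, Finset.sum_const_zero]

end AlternatingSums

/-! ### Positivity of a product of commuting projections -/

namespace Qubits

open Matrix

section Positivity

variable {m R 𝕜 A : Type*} [Fintype m]

theorem isSelfAdjoint_trace_mul [CommRing R] [StarRing R] {M N : Matrix m m R}
    (hM : M.IsHermitian) (hN : N.IsHermitian) : IsSelfAdjoint (M * N).trace := by
  rw [IsSelfAdjoint, ← trace_conjTranspose, conjTranspose_mul, hM.eq, hN.eq, trace_mul_comm]

variable [RCLike 𝕜]

theorem isStarProjection_inv_two_smul_one_sub [Ring A] [StarRing A] [Algebra 𝕜 A] [StarModule 𝕜 A]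
    {s : A} (hs : IsSelfAdjoint s) (hss : s * s = 1) :
    IsStarProjection ((2⁻¹ : 𝕜) • (1 - s)) where
  isIdempotentElem := by
    have hsq : (1 - s) * (1 - s) = (2 : 𝕜) • (1 - s) := by
      rw [ofNat_smul_eq_nsmul, two_nsmul, sub_mul, mul_sub, mul_sub, hss]
      noncomm_ring
    rw [IsIdempotentElem, smul_mul_smul_comm, hsq, smul_smul]
    norm_num
  isSelfAdjoint := by
    rw [IsSelfAdjoint, star_smul, star_sub, star_one, hs.star_eq, star_inv₀, star_ofNat]

theorem trace_mul_nonneg_of_isStarProjection {N P : Matrix m m 𝕜} (hN : N.PosSemidef)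
    (hP : IsStarProjection P) : 0 ≤ (N * P).trace := by
  have h : (N * P).trace = (P * N * Pᴴ).trace := by
    rw [← star_eq_conjTranspose, hP.isSelfAdjoint.star_eq, trace_mul_comm (P * N) P,
      ← Matrix.mul_assoc, hP.isIdempotentElem.eq, trace_mul_comm]
  rw [h]
  exact (hN.mul_mul_conjTranspose_same P).trace_nonneg

theorem trace_mul_one_sub_mul_one_sub_nonneg [DecidableEq m] {N S T : Matrix m m 𝕜}
    (hN : N.PosSemidef) (hS : S.IsHermitian) (hT : T.IsHermitian) (hSS : S * S = 1)
    (hTT : T * T = 1) (hST : Commute S T) : 0 ≤ (N * ((1 - S) * (1 - T))).trace := by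
  have hcomm : Commute (1 - S) (1 - T) :=
    ((Commute.one_left _).sub_left ((Commute.one_right _).sub_right hST))
  have h := trace_mul_nonneg_of_isStarProjection hN
    ((isStarProjection_inv_two_smul_one_sub (𝕜 := 𝕜) hS hSS).mul
      (isStarProjection_inv_two_smul_one_sub (𝕜 := 𝕜) hT hTT)
      ((hcomm.smul_left _).smul_right _))
  rw [smul_mul_smul_comm, Matrix.mul_smul, trace_smul, smul_eq_mul] at h
  simpa [← mul_assoc] using mul_nonneg (by positivity : (0 : 𝕜) ≤ 2 * 2) h

end Positivity

/-! ### Exchanging qubits between two copies -/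

section Swap

variable {V α : Type*} [DecidableEq V]

/-- The permutation of pairs of configurations that exchanges the coordinates in `J` between the
two copies. -/
def swapPerm (J : Finset V) : Equiv.Perm ((V → α) × (V → α)) where
  toFun p := (J.piecewise p.2 p.1, J.piecewise p.1 p.2)
  invFun p := (J.piecewise p.2 p.1, J.piecewise p.1 p.2)
  left_inv p := by ext v <;> by_cases hv : v ∈ J <;> simp [hv]
  right_inv p := by ext v <;> by_cases hv : v ∈ J <;> simp [hv]

theorem swapPerm_apply (J : Finset V) (p : (V → α) × (V → α)) :
    swapPerm J p = (J.piecewise p.2 p.1, J.piecewise p.1 p.2) := rfl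

theorem swapPerm_inv (J : Finset V) : (swapPerm (α := α) J)⁻¹ = swapPerm J := rfl

theorem swapPerm_empty : swapPerm (α := α) (∅ : Finset V) = 1 := by
  ext p v <;> simp [swapPerm_apply]

theorem swapPerm_mul (I J : Finset V) :
    swapPerm (α := α) I * swapPerm J = swapPerm (symmDiff I J) := by
  ext p v <;> by_cases hI : v ∈ I <;> by_cases hJ : v ∈ J <;>
    simp [swapPerm_apply, Finset.piecewise, Finset.mem_symmDiff, hI, hJ]

variable (R : Type*) [Fintype V] [DecidableEq α]

/-- The operator on two copies of a system that exchanges the sites in `J`. -/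
def swapOperator [Zero R] [One R] (J : Finset V) :
    Matrix ((V → α) × (V → α)) ((V → α) × (V → α)) R :=
  (swapPerm J).permMatrix R

theorem swapOperator_apply [Zero R] [One R] (J : Finset V) (p q : (V → α) × (V → α)) :
    swapOperator R J p q = if swapPerm J p = q then 1 else 0 := by
  simp [swapOperator, Equiv.Perm.permMatrix, PEquiv.toMatrix_apply, eq_comm]

theorem swapOperator_empty [Zero R] [One R] :
    swapOperator (α := α) R (∅ : Finset V) = 1 := by
  rw [swapOperator, swapPerm_empty, permMatrix_one]

theorem isHermitian_swapOperator [NonAssocSemiring R] [StarRing R] (J : Finset V) :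
    (swapOperator (α := α) R J).IsHermitian := by
  rw [IsHermitian, swapOperator, conjTranspose_permMatrix, swapPerm_inv]

theorem swapOperator_mul [Fintype α] [NonAssocSemiring R] (I J : Finset V) :
    swapOperator (α := α) R I * swapOperator R J = swapOperator R (symmDiff I J) := by
  rw [swapOperator, swapOperator, ← permMatrix_mul, swapPerm_mul, symmDiff_comm, swapOperator]

/-- The tensor product over all sites of `1 - F`, where `F` exchanges the two copies of a single
site, expanded into the operators `swapOperator R J`. No normalization is applied, so for qubits it
is `2 ^ n` times the product of the singlet projections. -/
def antisymmetrizer [Ring R] : Matrix ((V → α) × (V → α)) ((V → α) × (V → α)) R :=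
  ∑ J : Finset V, (-1 : R) ^ J.card • swapOperator R J

theorem trace_mul_antisymmetrizer [Fintype α] [CommRing R]
    (N : Matrix ((V → α) × (V → α)) ((V → α) × (V → α)) R) :
    (N * antisymmetrizer R).trace =
      ∑ J : Finset V, (-1) ^ J.card * (N * swapOperator R J).trace := by
  simp only [antisymmetrizer, Matrix.mul_sum, Matrix.mul_smul, trace_sum, trace_smul, smul_eq_mul]

variable {R}

theorem swapOperator_apply_eq_prod [CommSemiring R] (J : Finset V) (p q : (V → α) × (V → α)) :
    swapOperator R J p q =
      (∏ v ∈ Finset.univ \ J, if p.1 v = q.1 v ∧ p.2 v = q.2 v then (1 : R) else 0) *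
        ∏ v ∈ J, if p.2 v = q.1 v ∧ p.1 v = q.2 v then (1 : R) else 0 := by
  have hiff : swapPerm J p = q ↔ (∀ v ∈ Finset.univ \ J, p.1 v = q.1 v ∧ p.2 v = q.2 v) ∧
      ∀ v ∈ J, p.2 v = q.1 v ∧ p.1 v = q.2 v := by
    simp only [swapPerm_apply, Prod.ext_iff, funext_iff, ← forall_and, Finset.mem_sdiff,
      Finset.mem_univ, true_and]
    refine forall_congr' fun v => ?_
    by_cases hv : v ∈ J <;> simp [hv]
  simp only [swapOperator_apply, hiff, Finset.prod_ite_zero, Finset.prod_const_one,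
    ite_zero_mul_ite_zero, mul_one]

theorem antisymmetrizer_apply [CommRing R] (p q : (V → α) × (V → α)) :
    antisymmetrizer R p q = ∏ v, ((if p.1 v = q.1 v ∧ p.2 v = q.2 v then 1 else 0) -
      if p.2 v = q.1 v ∧ p.1 v = q.2 v then 1 else 0) := by
  simp only [antisymmetrizer, Matrix.sum_apply, Matrix.smul_apply, smul_eq_mul,
    swapOperator_apply_eq_prod, Finset.prod_sub, Finset.powerset_univ, mul_assoc]

end Swap

/-! ### Linear entropies and total correlations -/

section Entropy

open scoped Kronecker

variable {n : ℕ}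

theorem trace_marginal_mul_marginal (ρ σ : Operator n) (J : Finset (Fin n)) :
    (marginal ρ J * marginal σ J).trace = ((ρ ⊗ₖ σ) * swapOperator ℂ J).trace := by
  let e := Equiv.piEquivPiSubtypeProd (· ∈ J) fun _ => Fin 2
  have hpiecewise (a b c d) :
      J.piecewise (e.symm (a, d)) (e.symm (b, c)) = e.symm (a, c) := by
    ext i
    by_cases hi : i ∈ J <;> simp [e, Finset.piecewise, hi]
  have hswap : ((ρ ⊗ₖ σ) * swapOperator ℂ J).trace =
      ∑ x, ∑ y, ρ (J.piecewise y x) x * σ (J.piecewise x y) y := by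
    rw [trace_mul_comm, trace, Fintype.sum_prod_type]
    simp only [diag_apply, mul_apply, swapOperator_apply, kroneckerMap_apply, ite_mul, one_mul,
      zero_mul, Finset.sum_ite_eq, Finset.mem_univ, if_true]
    rfl
  rw [hswap, ← e.symm.sum_comp]
  simp_rw [← e.symm.sum_comp (fun y => ρ (J.piecewise y _) _ * σ _ y), Fintype.sum_prod_type,
    hpiecewise]
  simp only [trace, diag_apply, mul_apply, marginal, Finset.sum_mul_sum]
  rw [Finset.sum_comm]
  exact Finset.sum_congr rfl fun b _ => Finset.sum_comm

variable {ρ : Operator n}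

theorem ofReal_linearEntropy (hρ : ρ.IsHermitian) (J : Finset (Fin n)) :
    (linearEntropy ρ J : ℂ) = 1 - ((ρ ⊗ₖ ρ) * swapOperator ℂ J).trace := by
  have hreal : IsSelfAdjoint ((ρ ⊗ₖ ρ) * swapOperator ℂ J).trace :=
    isSelfAdjoint_trace_mul (by rw [IsHermitian, conjTranspose_kronecker, hρ.eq])
      (isHermitian_swapOperator ℂ J)
  rw [linearEntropy, trace_marginal_mul_marginal, Complex.ofReal_sub, Complex.ofReal_one,
    Complex.conj_eq_iff_re.1 hreal.star_eq]

theorem linearEntropy_empty (hρ : IsState ρ) : linearEntropy ρ ∅ = 0 := by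
  rw [linearEntropy, trace_marginal_mul_marginal, swapOperator_empty, Matrix.mul_one,
    trace_kronecker, hρ.2, mul_one, Complex.one_re, sub_self]

theorem linearEntropy_symmDiff_le (hρ : IsState ρ) (I J : Finset (Fin n)) :
    linearEntropy ρ (symmDiff I J) ≤ linearEntropy ρ I + linearEntropy ρ J := by
  have hsq (J : Finset (Fin n)) :
      swapOperator (α := Fin 2) ℂ J * swapOperator ℂ J = 1 := by
    rw [swapOperator_mul, symmDiff_self, Finset.bot_eq_empty, swapOperator_empty]
  have hcomm : Commute (swapOperator (α := Fin 2) ℂ I) (swapOperator ℂ J) := by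
    rw [Commute, SemiconjBy, swapOperator_mul, swapOperator_mul, symmDiff_comm]
  have hnonneg := trace_mul_one_sub_mul_one_sub_nonneg (hρ.1.kronecker hρ.1)
    (isHermitian_swapOperator ℂ I) (isHermitian_swapOperator ℂ J) (hsq I) (hsq J) hcomm
  have hexpand : ((ρ ⊗ₖ ρ) * ((1 - swapOperator ℂ I) * (1 - swapOperator ℂ J))).trace =
      ((linearEntropy ρ I + linearEntropy ρ J - linearEntropy ρ (symmDiff I J) : ℝ) : ℂ) := by
    push_cast
    simp only [ofReal_linearEntropy hρ.1.isHermitian, sub_mul, mul_sub, one_mul, mul_one,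
      swapOperator_mul, trace_sub, trace_kronecker, hρ.2]
    ring
  rw [hexpand, Complex.zero_le_real] at hnonneg
  linarith

theorem totalCorrelation_empty (hρ : IsState ρ) : totalCorrelation ρ ∅ = 0 := by
  rw [totalCorrelation, Finset.sum_empty, linearEntropy_empty hρ, sub_zero]

theorem totalCorrelation_singleton (ρ : Operator n) (v : Fin n) : totalCorrelation ρ {v} = 0 := by
  rw [totalCorrelation, Finset.sum_singleton, sub_self]

theorem monotone_totalCorrelation (hρ : IsState ρ) : Monotone (totalCorrelation ρ) := by
  rw [Finset.monotone_iff_forall_le_insert]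
  intro J v hv
  have hinsert : symmDiff {v} J = insert v J := by
    rw [(Finset.disjoint_singleton_left.2 hv).symmDiff_eq_sup, Finset.sup_eq_union,
      Finset.insert_eq]
  have hsub := linearEntropy_symmDiff_le hρ {v} J
  rw [hinsert] at hsub
  rw [totalCorrelation, totalCorrelation, Finset.sum_insert hv]
  linarith

theorem totalCorrelation_nonneg (hρ : IsState ρ) (J : Finset (Fin n)) :
    0 ≤ totalCorrelation ρ J :=
  (totalCorrelation_empty hρ).symm.trans_le (monotone_totalCorrelation hρ (Finset.empty_subset J))

theorem interactionInformation_eq_neg_sum (ρ : Operator n) :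
    interactionInformation ρ =
      -∑ J : Finset (Fin n) with J.Nonempty, (-1) ^ J.card * linearEntropy ρ J := by
  rw [interactionInformation, ← Finset.sum_neg_distrib]
  refine Finset.sum_congr rfl fun J hJ => ?_
  rw [neg_one_pow_card_sub_one (Finset.mem_filter.1 hJ).2, neg_mul]

theorem sum_neg_one_pow_card_mul_totalCorrelation [Nontrivial (Fin n)] (ρ : Operator n) :
    ∑ J : Finset (Fin n) with J.Nonempty, (-1) ^ J.card * totalCorrelation ρ J =
      interactionInformation ρ := by
  have hadditive := sum_neg_one_pow_card_mul_sum_eq_zero fun v : Fin n => linearEntropy ρ {v}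
  rw [sum_eq_empty_add_sum_nonempty, Finset.sum_empty, mul_zero, zero_add] at hadditive
  simp only [totalCorrelation, mul_sub, Finset.sum_sub_distrib, hadditive, zero_sub,
    interactionInformation_eq_neg_sum]

theorem interactionInformation_eq_trace [Nonempty (Fin n)] (hρ : IsState ρ) :
    (interactionInformation ρ : ℂ) = ((ρ ⊗ₖ ρ) * antisymmetrizer ℂ).trace := by
  have htrace : ((ρ ⊗ₖ ρ) * swapOperator ℂ ∅).trace = 1 := by
    rw [swapOperator_empty, Matrix.mul_one, trace_kronecker, hρ.2, mul_one]
  rw [interactionInformation_eq_neg_sum, trace_mul_antisymmetrizer, sum_eq_empty_add_sum_nonempty,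
    htrace, Finset.card_empty, pow_zero, one_mul]
  push_cast
  simp only [ofReal_linearEntropy hρ.1.isHermitian, mul_sub, mul_one, Finset.sum_sub_distrib,
    sum_nonempty_neg_one_pow_card]
  ring

end Entropy

/-! ### Pauli matrices and the antisymmetrizer -/

section Pauli

open scoped Kronecker

variable {n : ℕ}

theorem sum_neg_one_mul_pauli_mul_pauli (a b c d : Fin 2) :
    ∑ i : Fin 4, (if i ≠ 0 then (-1 : ℂ) else 1) * (pauli i a b * pauli i c d) =
      2 * ((if a = b ∧ c = d then 1 else 0) - if c = b ∧ a = d then 1 else 0) := by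
  fin_cases a <;> fin_cases b <;> fin_cases c <;> fin_cases d <;>
    simp [pauli, Fin.sum_univ_four] <;> norm_num

theorem pauli_two_mul_pauli_two (a b c d : Fin 2) :
    pauli 2 a c * pauli 2 d b =
      (if a = b ∧ c = d then 1 else 0) - if c = b ∧ a = d then 1 else 0 := by
  fin_cases a <;> fin_cases b <;> fin_cases c <;> fin_cases d <;> simp [pauli]

theorem neg_one_pow_weight (ι : Fin n → Fin 4) :
    (-1 : ℂ) ^ weight ι = ∏ j, if ι j ≠ 0 then -1 else 1 := by
  rw [Finset.prod_ite, Finset.prod_const, Finset.prod_const_one, mul_one, weight]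

theorem sum_neg_one_pow_weight_smul_pauliString_kronecker :
    ∑ ι : Fin n → Fin 4, (-1 : ℂ) ^ weight ι • (pauliString ι ⊗ₖ pauliString ι) =
      2 ^ n • antisymmetrizer ℂ := by
  ext p q
  rw [Matrix.smul_apply, antisymmetrizer_apply, nsmul_eq_mul]
  push_cast
  rw [← Fin.prod_const, ← Finset.prod_mul_distrib]
  simp only [← sum_neg_one_mul_pauli_mul_pauli, Fintype.prod_sum, Matrix.sum_apply,
    Matrix.smul_apply, smul_eq_mul, neg_one_pow_weight, kroneckerMap_apply, pauliString,
    Finset.prod_mul_distrib]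

theorem minkowskiLength_eq_trace (ρ : Operator n) :
    minkowskiLength ρ = ((ρ ⊗ₖ ρ) * antisymmetrizer ℂ).trace := by
  have hbloch (ι : Fin n → Fin 4) :
      blochVector ρ ι ^ 2 = ((ρ ⊗ₖ ρ) * (pauliString ι ⊗ₖ pauliString ι)).trace := by
    rw [← mul_kronecker_mul, trace_kronecker, ← blochVector, sq]
  have hsum := congrArg (fun M => ((ρ ⊗ₖ ρ) * M).trace)
    (sum_neg_one_pow_weight_smul_pauliString_kronecker (n := n))
  simp only [Matrix.mul_sum, Matrix.mul_smul, trace_sum, trace_smul, smul_eq_mul, ← hbloch] at hsum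
  rw [minkowskiLength, hsum, nsmul_eq_mul]
  push_cast
  rw [← mul_assoc, one_div_mul_cancel (pow_ne_zero n two_ne_zero), one_mul]

theorem antisymmetrizer_eq_vecMulVec :
    antisymmetrizer ℂ = vecMulVec (vec (pauliString fun _ : Fin n => 2)ᵀ)
      (vec (pauliString fun _ : Fin n => 2)) := by
  ext p q
  simp only [antisymmetrizer_apply, ← pauli_two_mul_pauli_two, vecMulVec_apply, vec, pauliString,
    transpose_apply, Finset.prod_mul_distrib]

theorem nTangle_eq_trace {ρ : Operator n} (hρ : ρ.IsHermitian) :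
    nTangle ρ = ((ρ ⊗ₖ ρ) * antisymmetrizer ℂ).trace := by
  have hconj : ρ.map (starRingEnd ℂ) = ρᵀ := by
    ext a b
    exact hρ.apply b a
  rw [antisymmetrizer_eq_vecMulVec, mul_vecMulVec, trace_vecMulVec, kronecker_mulVec_vec,
    vec_dotProduct_vec, nTangle, hconj, transpose_mul, transpose_mul, transpose_transpose,
    transpose_transpose, Matrix.mul_assoc ρ]

end Pauli

end Qubits

/-! ### Reduced homology of finite complexes -/

namespace Persistence

section Homology

variable {n m : ℕ} (K : Type*) [Field K] {G : PreAbstractSimplicialComplex (Fin n)}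

/-- The incidence sign of the vertex `v` relative to `J`, determined by the position that `v` has,
or would have after insertion, among the vertices of `J` in increasing order. -/
def vertexSign (J : Finset (Fin n)) (v : Fin n) : K :=
  (-1) ^ (J.filter (· < v)).card

theorem vertexSign_mul_self (J : Finset (Fin n)) (v : Fin n) :
    vertexSign K J v * vertexSign K J v = 1 := by
  rw [vertexSign, ← mul_pow, neg_one_mul, neg_neg, one_pow]

theorem vertexSign_insert_self {J : Finset (Fin n)} {a : Fin n} :
    vertexSign K (insert a J) a = vertexSign K J a := by
  rw [vertexSign, Finset.filter_insert, if_neg (lt_irrefl a), vertexSign]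

theorem vertexSign_mul_vertexSign_insert {J : Finset (Fin n)} {a v : Fin n} (ha : a ∉ J)
    (hv : v ∈ J) :
    vertexSign K J a * vertexSign K (insert a J) v =
      -(vertexSign K J v * vertexSign K (J.erase v) a) := by
  simp only [vertexSign, Finset.filter_insert, Finset.filter_erase]
  rcases (ne_of_mem_of_not_mem hv ha).lt_or_gt with hlt | hlt
  · rw [if_neg hlt.not_gt, ← Finset.card_erase_add_one (Finset.mem_filter.2 ⟨hv, hlt⟩), pow_succ]
    ring
  · have hnotMem : v ∉ J.filter (· < a) := fun h => hlt.not_gt (Finset.mem_filter.1 h).2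
    rw [if_pos hlt, Finset.card_insert_of_notMem fun h => ha (Finset.mem_filter.1 h).1, pow_succ,
      Finset.erase_eq_of_notMem hnotMem]
    ring

theorem Simplex.coe_face (σ : Simplex G (m + 1)) {v : Fin n} (hv : v ∈ σ.1) :
    (σ.face v hv).1 = σ.1.erase v := rfl

/-- The contribution of the vertex `v` to the boundary of the simplex `σ`: the face opposite to `v`
with its incidence sign, or zero if `v` is not a vertex of `σ`. -/
def signedFace (σ : Simplex G (m + 1)) (v : Fin n) : Chain K G m :=
  if h : v ∈ σ.1 then Pi.single (σ.face v h) (vertexSign K σ.1 v) else 0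

theorem signedFace_of_mem {σ : Simplex G (m + 1)} {v : Fin n} (h : v ∈ σ.1) :
    signedFace K σ v = Pi.single (σ.face v h) (vertexSign K σ.1 v) := dif_pos h

theorem signedFace_of_notMem {σ : Simplex G (m + 1)} {v : Fin n} (h : v ∉ σ.1) :
    signedFace K σ v = 0 := dif_neg h

theorem boundary_single (σ : Simplex G (m + 1)) (c : K) :
    boundary K G m (Pi.single σ c) = c • ∑ v, signedFace K σ v := by
  rw [boundary, Fintype.linearCombination_apply_single,
    ← Finset.sum_subset (Finset.subset_univ σ.1) fun v _ hv => signedFace_of_notMem K hv,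
    ← Finset.sum_coe_sort σ.1 (signedFace K σ)]
  exact congrArg (c • ·) (Finset.sum_congr rfl fun (v : {v // v ∈ σ.1}) _ =>
    (signedFace_of_mem K v.2).symm)

/-- The complex `G` is a cone with apex `a`: adjoining `a` to a face, or to the empty simplex,
yields a face. -/
def IsCone (G : PreAbstractSimplicialComplex (Fin n)) (a : Fin n) : Prop :=
  ∀ J : Finset (Fin n), J = ∅ ∨ J ∈ G.faces → insert a J ∈ G.faces

variable {a : Fin n}

/-- The join of a simplex with the apex of a cone. -/
def Simplex.cone (hG : IsCone G a) (σ : Simplex G m) (ha : a ∉ σ.1) : Simplex G (m + 1) :=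
  ⟨insert a σ.1, by rw [Finset.card_insert_of_notMem ha, σ.2.1], Or.inr (hG σ.1 σ.2.2)⟩

theorem Simplex.coe_cone (hG : IsCone G a) (σ : Simplex G m) (ha : a ∉ σ.1) :
    (σ.cone hG ha).1 = insert a σ.1 := rfl

/-- The operator that joins each simplex with the apex of a cone. The incidence sign of the apex
makes it a contracting homotopy even when the apex is not the least vertex. -/
noncomputable def coneOperator (hG : IsCone G a) (m : ℕ) : Chain K G m →ₗ[K] Chain K G (m + 1) :=
  Fintype.linearCombination K fun σ : Simplex G m =>
    if ha : a ∈ σ.1 then 0 else Pi.single (σ.cone hG ha) (vertexSign K σ.1 a)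

theorem coneOperator_single_of_mem (hG : IsCone G a) {σ : Simplex G m} (ha : a ∈ σ.1) (c : K) :
    coneOperator K hG m (Pi.single σ c) = 0 := by
  rw [coneOperator, Fintype.linearCombination_apply_single, dif_pos ha, smul_zero]

theorem coneOperator_single_of_notMem (hG : IsCone G a) {σ : Simplex G m} (ha : a ∉ σ.1) (c : K) :
    coneOperator K hG m (Pi.single σ c) =
      Pi.single (σ.cone hG ha) (c * vertexSign K σ.1 a) := by
  rw [coneOperator, Fintype.linearCombination_apply_single, dif_neg ha, ← Pi.single_smul,
    smul_eq_mul]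

theorem coneOperator_signedFace_of_mem (hG : IsCone G a) {σ : Simplex G (m + 1)} (ha : a ∈ σ.1)
    (v : Fin n) :
    coneOperator K hG m (signedFace K σ v) = if v = a then Pi.single σ 1 else 0 := by
  split_ifs with hva
  · subst hva
    have hcone : (σ.face v ha).cone hG (Finset.notMem_erase v σ.1) = σ :=
      Subtype.ext (Finset.insert_erase ha)
    have hsign : vertexSign K (σ.face v ha).1 v = vertexSign K σ.1 v := by
      rw [← vertexSign_insert_self, σ.coe_face, Finset.insert_erase ha]
    rw [signedFace_of_mem K ha, coneOperator_single_of_notMem K hG (Finset.notMem_erase v σ.1),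
      hcone, hsign, vertexSign_mul_self]
  · by_cases hv : v ∈ σ.1
    · rw [signedFace_of_mem K hv,
        coneOperator_single_of_mem K hG (Finset.mem_erase.2 ⟨Ne.symm hva, ha⟩)]
    · rw [signedFace_of_notMem K hv, map_zero]

theorem signedFace_cone_add_coneOperator_signedFace (hG : IsCone G a) {σ : Simplex G (m + 1)}
    (ha : a ∉ σ.1) (v : Fin n) :
    vertexSign K σ.1 a • signedFace K (σ.cone hG ha) v +
      coneOperator K hG m (signedFace K σ v) = if v = a then Pi.single σ 1 else 0 := by
  split_ifs with hva
  · subst hva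
    have hface : (σ.cone hG ha).face v (Finset.mem_insert_self v σ.1) = σ :=
      Subtype.ext (Finset.erase_insert ha)
    rw [signedFace_of_notMem K ha, map_zero, add_zero,
      signedFace_of_mem K (Finset.mem_insert_self v σ.1), hface, ← Pi.single_smul, σ.coe_cone,
      vertexSign_insert_self, smul_eq_mul, vertexSign_mul_self]
  by_cases hv : v ∈ σ.1
  · have hmem : v ∈ (σ.cone hG ha).1 := Finset.mem_insert_of_mem hv
    have hnotMem : a ∉ (σ.face v hv).1 := fun h => ha (Finset.mem_of_mem_erase h)
    have hcomm : (σ.cone hG ha).face v hmem = (σ.face v hv).cone hG hnotMem :=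
      Subtype.ext (Finset.erase_insert_of_ne (Ne.symm hva))
    rw [signedFace_of_mem K hmem, signedFace_of_mem K hv,
      coneOperator_single_of_notMem K hG hnotMem, hcomm, ← Pi.single_smul, ← Pi.single_add,
      σ.coe_cone, σ.coe_face, smul_eq_mul, vertexSign_mul_vertexSign_insert K ha hv,
      neg_add_cancel, Pi.single_zero]
  · rw [signedFace_of_notMem K hv, signedFace_of_notMem K fun h =>
      (Finset.mem_insert.1 h).elim hva hv, smul_zero, map_zero, add_zero]

theorem boundary_comp_coneOperator_add (hG : IsCone G a) (m : ℕ) :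
    boundary K G (m + 1) ∘ₗ coneOperator K hG (m + 1) + coneOperator K hG m ∘ₗ boundary K G m =
      LinearMap.id := by
  refine LinearMap.pi_ext' fun σ => LinearMap.ext_ring ?_
  simp only [LinearMap.comp_apply, LinearMap.single_apply, LinearMap.add_apply, LinearMap.id_apply,
    boundary_single, one_smul, map_sum]
  by_cases ha : a ∈ σ.1
  · simp only [coneOperator_single_of_mem K hG ha, map_zero, zero_add,
      coneOperator_signedFace_of_mem K hG ha, Finset.sum_ite_eq', Finset.mem_univ, if_true]
  · simp only [coneOperator_single_of_notMem K hG ha, one_mul, boundary_single, Finset.smul_sum,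
      ← Finset.sum_add_distrib, signedFace_cone_add_coneOperator_signedFace, Finset.sum_ite_eq',
      Finset.mem_univ, if_true]

variable (G)

theorem reducedBetti_add_finrank_range (k : ℕ) :
    reducedBetti K G k + Module.finrank K (LinearMap.range (boundary K G k)) +
      Module.finrank K (LinearMap.range (boundary K G (k + 1))) =
      Fintype.card (Simplex G (k + 1)) := by
  have hle : LinearMap.range (boundary K G (k + 1)) ≤ LinearMap.ker (boundary K G k) :=
    LinearMap.range_le_ker_iff.2 (boundary_comp_boundary K G k)
  have hquot : reducedBetti K G k + Module.finrank K (LinearMap.range (boundary K G (k + 1))) =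
      Module.finrank K (LinearMap.ker (boundary K G k)) := by
    rw [← (Submodule.submoduleOfEquivOfLe hle).finrank_eq]
    exact Submodule.finrank_quotient_add_finrank _
  have hrank := LinearMap.finrank_range_add_finrank_ker (boundary K G k)
  rw [Module.finrank_fintype_fun_eq_card] at hrank
  omega

variable {G} in
theorem reducedBetti_eq_zero_of_isCone (hG : IsCone G a) (k : ℕ) : reducedBetti K G k = 0 := by
  have hle : LinearMap.ker (boundary K G k) ≤ LinearMap.range (boundary K G (k + 1)) := by
    intro c hc
    have hhomotopy := LinearMap.congr_fun (boundary_comp_coneOperator_add K hG k) c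
    rw [LinearMap.add_apply, LinearMap.comp_apply, LinearMap.comp_apply, LinearMap.mem_ker.1 hc,
      map_zero, add_zero] at hhomotopy
    exact ⟨_, hhomotopy⟩
  have hker := Submodule.finrank_mono hle
  have hrank := LinearMap.finrank_range_add_finrank_ker (boundary K G k)
  have hbetti := reducedBetti_add_finrank_range K G k
  rw [Module.finrank_fintype_fun_eq_card] at hrank
  omega

theorem reducedBetti_eq_zero_of_isEmpty {k : ℕ} [IsEmpty (Simplex G (k + 1))] :
    reducedBetti K G k = 0 := by
  have hbetti := reducedBetti_add_finrank_range K G k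
  rw [Fintype.card_eq_zero] at hbetti
  omega

theorem isEmpty_simplex (hm : n < m) : IsEmpty (Simplex G m) :=
  ⟨fun σ => (σ.2.1 ▸ card_finset_fin_le σ.1).not_gt hm⟩

theorem reducedBetti_eq_zero_of_le {k : ℕ} (hk : n ≤ k) : reducedBetti K G k = 0 :=
  have := isEmpty_simplex G (Nat.lt_succ_of_le hk)
  reducedBetti_eq_zero_of_isEmpty K G

theorem reducedBetti_le (k : ℕ) : reducedBetti K G k ≤ Fintype.card (Finset (Fin n)) := by
  have hcard : Fintype.card (Simplex G (k + 1)) ≤ Fintype.card (Finset (Fin n)) :=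
    Fintype.card_le_of_injective (fun σ => σ.1) Subtype.val_injective
  have hbetti := reducedBetti_add_finrank_range K G k
  omega

variable {G}

theorem finrank_range_augmentation {v : Fin n} (hv : {v} ∈ G.faces) :
    Module.finrank K (LinearMap.range (boundary K G 0)) = 1 := by
  have hcard : Fintype.card (Simplex G 0) ≤ 1 := Fintype.card_le_one_iff.2 fun σ τ =>
    Subtype.ext ((Finset.card_eq_zero.1 σ.2.1).trans (Finset.card_eq_zero.1 τ.2.1).symm)
  let σ : Simplex G 1 := ⟨{v}, Finset.card_singleton v, Or.inr hv⟩
  have hvσ : v ∈ σ.1 := Finset.mem_singleton_self v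
  have hσ : boundary K G 0 (Pi.single σ 1) = Pi.single (σ.face v hvσ) (vertexSign K σ.1 v) := by
    rw [boundary_single, one_smul, ← signedFace_of_mem]
    exact Fintype.sum_eq_single v fun w hw => signedFace_of_notMem K (mt Finset.mem_singleton.1 hw)
  refine le_antisymm ((Submodule.finrank_le _).trans ?_) (Submodule.one_le_finrank_iff.2 ?_)
  · rwa [Module.finrank_fintype_fun_eq_card]
  · intro hbot
    rw [LinearMap.range_eq_bot.1 hbot, LinearMap.zero_apply, eq_comm, Pi.single_eq_zero_iff] at hσ
    exact left_ne_zero_of_mul_eq_one (vertexSign_mul_self K σ.1 v) hσ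

theorem card_filter_mem_faces_card_eq [DecidablePred (· ∈ G.faces)] (m : ℕ) :
    (Finset.univ.filter fun J => J ∈ G.faces ∧ J.card = m + 1).card =
      Fintype.card (Simplex G (m + 1)) := by
  rw [← Fintype.card_subtype, ← Nat.card_eq_fintype_card, ← Nat.card_eq_fintype_card]
  refine Nat.card_congr (Equiv.subtypeEquivRight fun J => ?_)
  rw [and_comm]
  refine and_congr_right fun hJ => (or_iff_right ?_).symm
  rintro rfl
  exact Nat.succ_ne_zero m hJ.symm

theorem sum_mem_faces_eq_sum_card_simplex {R : Type*} [Semiring R] [DecidablePred (· ∈ G.faces)]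
    (f : ℕ → R) :
    ∑ J with J ∈ G.faces, f J.card =
      ∑ k ∈ Finset.range n, (Fintype.card (Simplex G (k + 1)) : R) * f (k + 1) := by
  have hmaps (J : Finset (Fin n)) (_ : J ∈ Finset.univ.filter (· ∈ G.faces)) :
      J.card ∈ Finset.range (n + 1) :=
    Finset.mem_range.2 (Nat.lt_succ_of_le (card_finset_fin_le J))
  have hempty : Finset.univ.filter (fun J => J ∈ G.faces ∧ J.card = 0) = ∅ :=
    Finset.filter_eq_empty_iff.2 fun J _ hJ =>
      (G.isRelLowerSet_faces hJ.1).1.card_ne_zero hJ.2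
  have hfiber (k : ℕ) : ∑ J with J ∈ G.faces ∧ J.card = k, f J.card =
      ((Finset.univ.filter fun J => J ∈ G.faces ∧ J.card = k).card : R) * f k := by
    rw [← nsmul_eq_mul]
    exact Finset.sum_eq_card_nsmul fun J hJ => congrArg f (Finset.mem_filter.1 hJ).2.2
  rw [← Finset.sum_fiberwise_of_maps_to hmaps, Finset.sum_range_succ']
  simp only [Finset.filter_filter, hfiber, hempty, Finset.sum_empty, add_zero,
    card_filter_mem_faces_card_eq]

theorem sum_neg_one_pow_mul_reducedBetti [DecidablePred (· ∈ G.faces)] {v : Fin n}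
    (hv : {v} ∈ G.faces) :
    ∑ k ∈ Finset.range n, (-1 : ℤ) ^ k * reducedBetti K G k =
      -1 - ∑ J with J ∈ G.faces, (-1 : ℤ) ^ J.card := by
  let r (k : ℕ) : ℤ := Module.finrank K (LinearMap.range (boundary K G k))
  have hr_zero : r 0 = 1 := congrArg Nat.cast (finrank_range_augmentation K hv)
  have hr_top : r n = 0 := by
    have := isEmpty_simplex G (Nat.lt_succ_self n)
    have hbetti := reducedBetti_add_finrank_range K G n
    rw [Fintype.card_eq_zero] at hbetti
    simp only [r]
    omega
  have hterm (k : ℕ) : (-1 : ℤ) ^ k * reducedBetti K G k =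
      -((Fintype.card (Simplex G (k + 1)) : ℤ) * (-1) ^ (k + 1)) -
        ((-1) ^ k * r k - (-1) ^ (k + 1) * r (k + 1)) := by
    rw [← reducedBetti_add_finrank_range K G k]
    push_cast
    ring
  rw [Finset.sum_congr rfl fun k _ => hterm k, Finset.sum_sub_distrib, Finset.sum_neg_distrib,
    Finset.sum_range_sub' fun k => (-1) ^ k * r k, hr_zero, hr_top,
    ← sum_mem_faces_eq_sum_card_simplex]
  ring

end Homology

/-! ### Integration along a filtration -/

section Filtration

open MeasureTheory

variable {n : ℕ} (K : Type*) [Field K] {F : Finset (Fin n) → ℝ} (hF : IsFaceMonotone F)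

theorem measurable_faces_sublevelComplex :
    Measurable fun t => (sublevelComplex F hF t).faces :=
  measurable_set_iff.2 fun _ => measurable_const.and measurableSet_Ici.mem

theorem measurable_reducedBetti_sublevelComplex (k : ℕ) :
    Measurable fun t => reducedBetti K (sublevelComplex F hF t) k := by
  have hfactors : Function.FactorsThrough (fun t => reducedBetti K (sublevelComplex F hF t) k)
      fun t => (sublevelComplex F hF t).faces :=
    fun _ _ h => congrArg (reducedBetti K · k) (PreAbstractSimplicialComplex.ext h)
  obtain ⟨g, hg⟩ := (Function.factorsThrough_iff _).1 hfactors
  rw [hg]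
  exact (measurable_of_countable g).comp (measurable_faces_sublevelComplex hF)

theorem reducedBetti_sublevelComplex_eq_zero_of_lt {t : ℝ} (ht : ∀ J, t < F J) (k : ℕ) :
    reducedBetti K (sublevelComplex F hF t) k = 0 := by
  have : IsEmpty (Simplex (sublevelComplex F hF t) (k + 1)) := ⟨fun σ => by
    obtain ⟨J, hcard, rfl | hJ⟩ := σ
    · exact Nat.succ_ne_zero k hcard.symm
    · exact (ht J).not_ge hJ.2⟩
  exact reducedBetti_eq_zero_of_isEmpty K _

theorem reducedBetti_sublevelComplex_eq_zero_of_le {t : ℝ} (ht : ∀ J, F J ≤ t) (k : ℕ) :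
    reducedBetti K (sublevelComplex F hF t) k = 0 := by
  obtain rfl | hn := Nat.eq_zero_or_pos n
  · exact reducedBetti_eq_zero_of_le K _ (Nat.zero_le k)
  · have hcone : IsCone (sublevelComplex F hF t) ⟨0, hn⟩ := fun J _ =>
      ⟨Finset.insert_nonempty _ J, ht _⟩
    exact reducedBetti_eq_zero_of_isCone K hcone k

theorem integrable_reducedBetti_sublevelComplex (k : ℕ) :
    Integrable fun t => (reducedBetti K (sublevelComplex F hF t) k : ℝ) := by
  obtain ⟨a, ha⟩ := (Set.finite_range F).bddBelow
  obtain ⟨b, hb⟩ := (Set.finite_range F).bddAbove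
  have hbounded : IntegrableOn (fun t => (reducedBetti K (sublevelComplex F hF t) k : ℝ))
      (Set.Icc a b) := by
    refine Measure.integrableOn_of_bounded (M := Fintype.card (Finset (Fin n)))
      measure_Icc_lt_top.ne
      (measurable_from_nat.comp
        (measurable_reducedBetti_sublevelComplex K hF k)).aestronglyMeasurable
      (.of_forall fun t => ?_)
    rw [Real.norm_natCast, Nat.cast_le]
    exact reducedBetti_le K _ k
  refine hbounded.integrable_of_forall_notMem_eq_zero fun t ht => Nat.cast_eq_zero.2 ?_
  rcases lt_or_ge t a with hta | hat
  · exact reducedBetti_sublevelComplex_eq_zero_of_lt K hF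
      (fun J => hta.trans_le (ha ⟨J, rfl⟩)) k
  · have hbt : b < t := not_le.1 fun htb => ht ⟨hat, htb⟩
    exact reducedBetti_sublevelComplex_eq_zero_of_le K hF
      (fun J => (hb ⟨J, rfl⟩).trans hbt.le) k

theorem integral_indicator_Ici_one {a b c : ℝ} (hab : a ≤ b) (hcb : c ≤ b) :
    ∫ t in a..b, (Set.Ici c).indicator (1 : ℝ → ℝ) t = b - max a c := by
  rw [intervalIntegral.integral_of_le hab, integral_indicator_one measurableSet_Ici,
    measureReal_restrict_apply measurableSet_Ici, Set.inter_comm, ← measureReal_congr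
      (Filter.EventuallyEq.rfl.inter Ioi_ae_eq_Ici), Set.Ioc_inter_Ioi,
    Real.volume_real_Ioc_of_le (max_le hab hcb)]

theorem reducedIEC_eq_integral (ε : ℝ) :
    reducedIEC K F hF ε = ∫ t in (0 : ℝ)..ε, ∑ k ∈ Finset.range n,
      (-1 : ℝ) ^ k * reducedBetti K (sublevelComplex F hF t) k := by
  have hvanish (k : ℕ) (hk : k ∉ Finset.range n) :
      (-1 : ℝ) ^ k * reducedIntegratedBetti K F hF k ε = 0 := by
    simp only [reducedIntegratedBetti,
      reducedBetti_eq_zero_of_le K _ (not_lt.1 (mt Finset.mem_range.2 hk)), Nat.cast_zero,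
      intervalIntegral.integral_zero, mul_zero]
  rw [reducedIEC, tsum_eq_sum hvanish, intervalIntegral.integral_finsetSum fun k _ =>
    ((integrable_reducedBetti_sublevelComplex K hF k).intervalIntegrable.const_mul _)]
  simp only [reducedIntegratedBetti, intervalIntegral.integral_const_mul]

theorem sum_neg_one_pow_mul_reducedBetti_sublevelComplex {v : Fin n} {t : ℝ} (hv : F {v} ≤ t) :
    ∑ k ∈ Finset.range n, (-1 : ℝ) ^ k * reducedBetti K (sublevelComplex F hF t) k =
      -1 - ∑ J : Finset (Fin n) with J.Nonempty,
        (-1) ^ J.card * (Set.Ici (F J)).indicator 1 t := by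
  classical
  have hEuler := congrArg (Int.cast : ℤ → ℝ) (sum_neg_one_pow_mul_reducedBetti K
    (G := sublevelComplex F hF t) (v := v) ⟨Finset.singleton_nonempty v, hv⟩)
  push_cast at hEuler
  rw [hEuler]
  simp only [Set.indicator_apply, Set.mem_Ici, Pi.one_apply, mul_ite, mul_one, mul_zero,
    ← Finset.sum_filter, Finset.filter_filter]
  congr!

theorem reducedIEC_eq {ε : ℝ} (hε : 0 ≤ ε) {v : Fin n} (hv : F {v} ≤ 0) (hFε : ∀ J, F J ≤ ε) :
    reducedIEC K F hF ε =
      ∑ J : Finset (Fin n) with J.Nonempty, (-1) ^ J.card * max 0 (F J) := by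
  have hstep (J : Finset (Fin n)) : IntervalIntegrable
      (fun t => (-1 : ℝ) ^ J.card * (Set.Ici (F J)).indicator 1 t) volume 0 ε :=
    (intervalIntegrable_iff.2
      ((integrableOn_const (C := (1 : ℝ)) (by simp)).indicator measurableSet_Ici)).const_mul _
  have hsum : IntervalIntegrable (fun t => ∑ J : Finset (Fin n) with J.Nonempty,
      (-1 : ℝ) ^ J.card * (Set.Ici (F J)).indicator 1 t) volume 0 ε := by
    simpa only [Finset.sum_fn] using IntervalIntegrable.sum _ fun J _ => hstep J
  have hpointwise : Set.EqOn
      (fun t => ∑ k ∈ Finset.range n, (-1 : ℝ) ^ k * reducedBetti K (sublevelComplex F hF t) k)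
      (fun t => -1 - ∑ J : Finset (Fin n) with J.Nonempty,
        (-1) ^ J.card * (Set.Ici (F J)).indicator 1 t) (Set.uIcc 0 ε) := fun t ht =>
    sum_neg_one_pow_mul_reducedBetti_sublevelComplex K hF
      (hv.trans (Set.uIcc_of_le hε ▸ ht).1)
  have : Nonempty (Fin n) := ⟨v⟩
  rw [reducedIEC_eq_integral, intervalIntegral.integral_congr hpointwise,
    intervalIntegral.integral_sub intervalIntegrable_const hsum,
    intervalIntegral.integral_finsetSum fun J _ => hstep J]
  simp only [intervalIntegral.integral_const, intervalIntegral.integral_const_mul,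
    integral_indicator_Ici_one hε (hFε _), mul_sub, Finset.sum_sub_distrib, ← Finset.sum_mul,
    sum_nonempty_neg_one_pow_card, smul_eq_mul]
  ring

theorem tendsto_reducedIEC {v : Fin n} (hv : F {v} ≤ 0) :
    Filter.Tendsto (reducedIEC K F hF) Filter.atTop
      (nhds (∑ J : Finset (Fin n) with J.Nonempty, (-1) ^ J.card * max 0 (F J))) := by
  obtain ⟨M, hM⟩ := (Set.finite_range F).bddAbove
  refine tendsto_const_nhds.congr' ?_
  filter_upwards [Filter.eventually_ge_atTop 0, Filter.eventually_ge_atTop M] with ε hε hMε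
  exact (reducedIEC_eq K hF hε hv fun J => (hM ⟨J, rfl⟩).trans hMε).symm

end Filtration

end Persistence

theorem mainTheorem2_general (n : ℕ) (hn : 2 ≤ n) (ρ : Qubits.Operator n)
    (hρ : Qubits.IsState ρ) (K : Type*) [Field K] :
    ∃ hC : Persistence.IsFaceMonotone (Qubits.totalCorrelation ρ),
      (∀ k : ℕ, MeasureTheory.IntegrableOn
        (fun ε : ℝ => (Persistence.reducedBetti K
          (Persistence.sublevelComplex (Qubits.totalCorrelation ρ) hC ε) k : ℝ)) (Set.Ioi 0)) ∧
      Filter.Tendsto (Persistence.reducedIEC K (Qubits.totalCorrelation ρ) hC) Filter.atTop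
        (nhds (Qubits.interactionInformation ρ)) ∧
      (Qubits.interactionInformation ρ : ℂ) = Qubits.minkowskiLength ρ ∧
      Qubits.minkowskiLength ρ = Qubits.nTangle ρ := by
  have : Nontrivial (Fin n) := Fin.nontrivial_iff_two_le.2 hn
  have hC : Persistence.IsFaceMonotone (Qubits.totalCorrelation ρ) :=
    fun _ _ _ hIJ => Qubits.monotone_totalCorrelation hρ hIJ
  have hlimit := Persistence.tendsto_reducedIEC K hC (v := ⟨0, by omega⟩)
    (Qubits.totalCorrelation_singleton ρ _).le
  simp only [max_eq_right (Qubits.totalCorrelation_nonneg hρ _),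
    Qubits.sum_neg_one_pow_card_mul_totalCorrelation] at hlimit
  refine ⟨hC, fun k => ?_, hlimit, ?_, ?_⟩
  · exact (Persistence.integrable_reducedBetti_sublevelComplex K hC k).integrableOn
  · rw [Qubits.interactionInformation_eq_trace hρ, Qubits.minkowskiLength_eq_trace]
  · rw [Qubits.minkowskiLength_eq_trace, Qubits.nTangle_eq_trace hρ.1.isHermitian]

theorem mainTheorem2 (n : ℕ) (hn0 : 0 < n) (hn : Even n) (ρ : Qubits.Operator n)
    (hρ : Qubits.IsState ρ) (K : Type*) [Field K] :
    ∃ hC : Persistence.IsFaceMonotone (Qubits.totalCorrelation ρ),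
      (∀ k : ℕ, MeasureTheory.IntegrableOn
        (fun ε : ℝ => (Persistence.reducedBetti K
          (Persistence.sublevelComplex (Qubits.totalCorrelation ρ) hC ε) k : ℝ)) (Set.Ioi 0)) ∧
      Filter.Tendsto (Persistence.reducedIEC K (Qubits.totalCorrelation ρ) hC) Filter.atTop
        (nhds (Qubits.interactionInformation ρ)) ∧
      (Qubits.interactionInformation ρ : ℂ) = Qubits.minkowskiLength ρ ∧
      Qubits.minkowskiLength ρ = Qubits.nTangle ρ := by
  obtain ⟨m, rfl⟩ := hn
  exact mainTheorem2_general (m + m) (by omega) ρ hρ K
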